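/- Let $k\ge 0$ be an integer (empty products are $1$) and let $a\in\{0,1\}$; the sign $\pm$ is $+$ for $a=0$ and $-$ for $a=1$. Put $$X(s,a)=\pi^{s-\frac12}\,\frac{\Gamma\left(\frac{1-s+a}{2}\right)}{\Gamma\left(\frac{s+a}{2}\right)},\qquad \Delta(w_1,\dots,w_k)=\det\left(w_i^{j-1}\right)_{1\le i,j\le k},$$ $$A_k(z_1,\dots,z_k)=\prod_p\ \prod_{1\le i\le j\le k}\left(1-\frac1{p^{1+z_i+z_j}}\right)\left(\frac12\left(\prod_{j=1}^k\left(1-\frac1{p^{\frac12+z_j}}\right)^{-1}+\prod_{j=1}^k\left(1+\frac1{p^{\frac12+z_j}}\right)^{-1}\right)+\frac1p\right)\left(1+\frac1p\right)^{-1},$$ the outer product being over all primes $p$, and let $a_k=A_k(0,\dots,0)$ and $$G_\pm(z_1,\dots,z_k)=A_k(z_1,\dots,z_k)\prod_{j=1}^kX\left(\tfrac12+z_j,a\right)^{-1/2}\prod_{1\le i\le j\le k}\zeta(1+z_i+z_j),$$ with the principal branch of the power $-1/2$ (note $X(\tfrac12,a)=1$). Define $$Q_\pm(k,x)=\frac{(-1)^{k(k-1)/2}\,2^k}{k!}\,\frac1{(2\pi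 i)^k}\oint\cdots\oint\frac{G_\pm(z_1,\dots,z_k)\,\Delta(z_1^2,\dots,z_k^2)^2}{\prod_{j=1}^kz_j^{2k-1}}\;e^{\frac x2\sum_{j=1}^kz_j}\,dz_1\cdots dz_k,$$ where $z_j$ runs once counterclockwise through a circle $|z_j|=R_j$. Then there is $\rho>0$, depending only on $k$ and $a$, such that the Euler product for $A_k$ converges absolutely when $|z_j|<\rho$ for all $j$, and such that for all radii $0<R_j<\rho$ and all $x\in\mathbb C$ the integrand is integrable on the torus and the value $Q_\pm(k,x)$ does not depend on the radii. As a function of $x$, $Q_\pm(k,x)$ is a polynomial of degree exactly $k(k+1)/2$, and its leading coefficient $c_\pm(0,k)$, that is, the coefficient of $x^{k(k+1)/2}$, is $$c_\pm(0,k)=\frac{a_k}{2^k}\prod_{j=0}^{k-1}\frac{(2j)!}{(k+j)!}.$$ -/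

import Mathlib

open scoped BigOperators Nat

noncomputable section

namespace QuadMoment

/-- The factor `X(s, a) = π^(s - 1/2) Γ((1 - s + a)/2) / Γ((s + a)/2)` of the functional equation of
`L(s, χ_d)`, where `a = 0` for `d > 0` and `a = 1` for `d < 0`. -/
def gammaFactor (a : ℕ) (s : ℂ) : ℂ :=
  (Real.pi : ℂ) ^ (s - 1 / 2) * Complex.Gamma ((1 - s + a) / 2) / Complex.Gamma ((s + a) / 2)

/-- The local factor at the prime `p` of the Euler product `A_k(z_1, …, z_k)`. -/
def eulerFactor (k : ℕ) (z : Fin k → ℂ) (p : Nat.Primes) : ℂ :=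
  (∏ i : Fin k, ∏ j ∈ Finset.Ici i, (1 - 1 / (p : ℂ) ^ (1 + z i + z j))) *
    (1 / 2 * ((∏ j : Fin k, (1 - 1 / (p : ℂ) ^ (1 / 2 + z j))⁻¹) +
        ∏ j : Fin k, (1 + 1 / (p : ℂ) ^ (1 / 2 + z j))⁻¹) + 1 / (p : ℂ)) *
    (1 + 1 / (p : ℂ))⁻¹

/-- The Euler product `A_k(z_1, …, z_k)`. -/
def eulerA (k : ℕ) (z : Fin k → ℂ) : ℂ :=
  ∏' p : Nat.Primes, eulerFactor k z p

/-- The arithmetic constant `a_k = A_k(0, …, 0)`. -/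
def arithConst (k : ℕ) : ℂ :=
  eulerA k (fun _ => 0)

/-- `G_+` (for `a = 0`) and `G_-` (for `a = 1`). Since `X(1/2, a) = 1`, the principal value of the
power `-1/2` is the holomorphic branch near the origin that is `1` at the origin. -/
def G (a k : ℕ) (z : Fin k → ℂ) : ℂ :=
  eulerA k z * (∏ j : Fin k, gammaFactor a (1 / 2 + z j) ^ (-(1 / 2) : ℂ)) *
    ∏ i : Fin k, ∏ j ∈ Finset.Ici i, riemannZeta (1 + z i + z j)

/-- The Vandermonde determinant `Δ(w_1, …, w_k) = det (w_i^(j-1))`. -/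
def vandermondeDet {k : ℕ} (w : Fin k → ℂ) : ℂ :=
  (Matrix.vandermonde w).det

/-- The integrand of the `k`-fold residue that defines `Q_±(k, x)`. -/
def integrand (a k : ℕ) (x : ℂ) (z : Fin k → ℂ) : ℂ :=
  G a k z * vandermondeDet (fun j => z j ^ 2) ^ 2 / (∏ j : Fin k, z j ^ (2 * k - 1)) *
    Complex.exp (x / 2 * ∑ j : Fin k, z j)

/-- `Q_+(k, x)` (for `a = 0`) and `Q_-(k, x)` (for `a = 1`), the variable `z_j` running once
counterclockwise through the circle of radius `R j` about `0`. The `k`-fold residue is the common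
value for all sufficiently small radii. -/
def Q (a k : ℕ) (R : Fin k → ℝ) (x : ℂ) : ℂ :=
  (-1) ^ (k * (k - 1) / 2) * 2 ^ k / (k ! : ℂ) * (1 / (2 * Real.pi * Complex.I) ^ k) *
    torusIntegral (integrand a k x) 0 R

end QuadMoment

end

/-! The poles of the zeta factors are split off by writing `ζ(1+s)` as `zetaReg s / s`. Since `Δ(z²)
= Δ(z) ∏_{i<j} (z_i + z_j)`, one of the two factors `Δ(z²)` absorbs the off-diagonal poles, and the
diagonal ones contribute `2^k ∏ z_j` to the denominator. The integrand becomes `2^{-k} F(z) L(z)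
e^{(x/2) Σ z_j}` with `F = regularG` holomorphic near `0`, `F(0) = a_k`, and `L = kernel`
homogeneous of degree `-(N+k)`, where `N = k(k+1)/2` (`integrand_eq`, `kernel_homogeneous`).

Torus integrals of separately holomorphic functions do not depend on the radii
(`SepHolo.torusIntegral_eq`). Shrinking all radii by `t → 0` therefore kills the moments of `F L`
against `(Σ z_j)^m` for `m > N`, and for `m = N` replaces `F` by `F(0)` (`moment_add`). Expanding
the exponential gives a polynomial of degree at most `N`.

Its top coefficient reduces to the integral of `L(z) e^{Σ z_j}`. Expanding both Vandermonde
determinants turns this into `k!` times a determinant of inverse factorials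
(`torusIntegral_kernel_exp_eq_det`), which falling factorials reduce to a Vandermonde determinant
(`det_invFactorial`). The degree is exact because `a_k ≠ 0`.

The Euler product converges because the second-order terms of each local factor cancel, leaving `1 +
O(p^{-5/4})` (`exists_norm_local_sub_one_le`). -/

open MeasureTheory Filter Topology

namespace QuadMoment

/-! ### Separately holomorphic functions and torus integrals -/

/-- The set of points all of whose coordinates have modulus less than `ρ`. -/
def polydisc (k : ℕ) (ρ : ℝ) : Set (Fin k → ℂ) := {z | ∀ j, ‖z j‖ < ρ}

/-- The points of the polydisc with no vanishing coordinate. -/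
def punctPolydisc (k : ℕ) (ρ : ℝ) : Set (Fin k → ℂ) := {z | ∀ j, z j ≠ 0 ∧ ‖z j‖ < ρ}

/-- Continuity together with holomorphy in each variable separately. -/
structure SepHolo {k : ℕ} (f : (Fin k → ℂ) → ℂ) (U : Set (Fin k → ℂ)) : Prop where
  cont : ContinuousOn f U
  diff : ∀ z ∈ U, ∀ j, DifferentiableAt ℂ (fun w => f (Function.update z j w)) (z j)

lemma isOpen_polydisc (k : ℕ) (ρ : ℝ) : IsOpen (polydisc k ρ) := by
  simp only [polydisc, Set.ofPred_forall]
  exact isOpen_iInter_of_finite fun j => isOpen_lt (by fun_prop) continuous_const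

lemma punctPolydisc_subset (k : ℕ) (ρ : ℝ) : punctPolydisc k ρ ⊆ polydisc k ρ :=
  fun _ hz j => (hz j).2

lemma continuous_torusMap {k : ℕ} (c : Fin k → ℂ) (R : Fin k → ℝ) : Continuous (torusMap c R) := by
  unfold torusMap
  fun_prop

lemma norm_torusMap_zero {k : ℕ} {R : Fin k → ℝ} (hR : ∀ j, 0 < R j) (θ : Fin k → ℝ) (j : Fin k) :
    ‖torusMap 0 R θ j‖ = R j := by
  simp [torusMap, Complex.norm_exp_ofReal_mul_I, abs_of_pos (hR j)]

lemma torusMap_mem_punctPolydisc {k : ℕ} {R : Fin k → ℝ} {ρ : ℝ} (hR : ∀ j, 0 < R j ∧ R j < ρ)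
    (θ : Fin k → ℝ) : torusMap 0 R θ ∈ punctPolydisc k ρ := fun j => by
  have h := norm_torusMap_zero (fun j => (hR j).1) θ j
  exact ⟨norm_pos_iff.1 (h ▸ (hR j).1), h ▸ (hR j).2⟩

lemma ContinuousOn.continuous_comp_torusMap {k : ℕ} {f : (Fin k → ℂ) → ℂ} {R : Fin k → ℝ} {ρ : ℝ}
    (hf : ContinuousOn f (punctPolydisc k ρ)) (hR : ∀ j, 0 < R j ∧ R j < ρ) :
    Continuous fun θ => f (torusMap 0 R θ) :=
  hf.comp_continuous (continuous_torusMap _ _) (torusMap_mem_punctPolydisc hR)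

lemma ContinuousOn.torusIntegrable {k : ℕ} {f : (Fin k → ℂ) → ℂ} {R : Fin k → ℝ} {ρ : ℝ}
    (hf : ContinuousOn f (punctPolydisc k ρ)) (hR : ∀ j, 0 < R j ∧ R j < ρ) :
    TorusIntegrable f 0 R :=
  (ContinuousOn.continuous_comp_torusMap hf hR).continuousOn.integrableOn_compact isCompact_Icc

lemma torusIntegral_congr {k : ℕ} {f g : (Fin k → ℂ) → ℂ} {R : Fin k → ℝ} {ρ : ℝ}
    (hR : ∀ j, 0 < R j ∧ R j < ρ) (h : ∀ z ∈ punctPolydisc k ρ, f z = g z) :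
    torusIntegral f 0 R = torusIntegral g 0 R := by
  unfold torusIntegral
  congr 1
  ext θ
  rw [h _ (torusMap_mem_punctPolydisc hR θ)]

lemma insertNth_mem_punctPolydisc {k : ℕ} {ρ : ℝ} {i : Fin (k + 1)} {x : ℂ} {y : Fin k → ℂ}
    (hx : x ≠ 0 ∧ ‖x‖ < ρ) (hy : y ∈ punctPolydisc k ρ) :
    i.insertNth (α := fun _ => ℂ) x y ∈ punctPolydisc (k + 1) ρ := by
  intro j
  induction j using Fin.succAboveCases i with
  | x => simpa using hx
  | p j => simpa using hy j

lemma SepHolo.insertNth {k : ℕ} {f : (Fin (k + 1) → ℂ) → ℂ} {ρ : ℝ}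
    (hf : SepHolo f (punctPolydisc (k + 1) ρ)) (i : Fin (k + 1)) {x : ℂ} (hx : x ≠ 0 ∧ ‖x‖ < ρ) :
    SepHolo (fun y => f (i.insertNth (α := fun _ => ℂ) x y)) (punctPolydisc k ρ) where
  cont := hf.cont.comp (by fun_prop) fun y hy => insertNth_mem_punctPolydisc hx hy
  diff y hy j := by
    simpa [Fin.insertNth_update] using
      hf.diff _ (insertNth_mem_punctPolydisc (i := i) hx hy) (i.succAbove j)

/-- Cauchy's theorem on the closed annulus between the two circles, which avoids `0`. -/
lemma circleIntegral_eq_of_punctured {f : ℂ → ℂ} {ρ r s : ℝ}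
    (hf : ∀ z, z ≠ 0 → ‖z‖ < ρ → DifferentiableAt ℂ f z) (hr : 0 < r) (hrs : r ≤ s) (hs : s < ρ) :
    (∮ z in C(0, s), f z) = ∮ z in C(0, r), f z := by
  have key : ∀ z ∈ Metric.closedBall (0 : ℂ) s \ Metric.ball 0 r, DifferentiableAt ℂ f z := by
    intro z hz
    simp only [Set.mem_sdiff, Metric.mem_closedBall, Metric.mem_ball, dist_zero_right, not_lt] at hz
    exact hf z (norm_pos_iff.1 (hr.trans_le hz.2)) (hz.1.trans_lt hs)
  refine Complex.circleIntegral_eq_of_differentiable_on_annulus_off_countable hr hrs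
    Set.countable_empty (fun z hz => (key z hz).continuousAt.continuousWithinAt) fun z hz => ?_
  exact key z ⟨Metric.ball_subset_closedBall hz.1.1, fun h =>
    hz.1.2 (Metric.ball_subset_closedBall h)⟩

lemma torusIntegral_insertNth_congr {k : ℕ} {f : (Fin (k + 1) → ℂ) → ℂ} {ρ : ℝ}
    (hf : ContinuousOn f (punctPolydisc (k + 1) ρ)) {R R' : Fin (k + 1) → ℝ}
    (hR : ∀ j, 0 < R j ∧ R j < ρ) (hR' : ∀ j, 0 < R' j ∧ R' j < ρ) (i : Fin (k + 1))
    (hi : R i = R' i)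
    (h : ∀ x : ℂ, x ≠ 0 ∧ ‖x‖ < ρ →
      torusIntegral (fun y => f (i.insertNth (α := fun _ => ℂ) x y)) 0 (R ∘ i.succAbove) =
      torusIntegral (fun y => f (i.insertNth (α := fun _ => ℂ) x y)) 0 (R' ∘ i.succAbove)) :
    torusIntegral f 0 R = torusIntegral f 0 R' := by
  rw [torusIntegral_succAbove (ContinuousOn.torusIntegrable hf hR) i,
    torusIntegral_succAbove (ContinuousOn.torusIntegrable hf hR') i, ← hi]
  refine circleIntegral.integral_congr (hR i).1.le fun x hx => ?_
  have hx' : ‖x‖ = R i := by simpa using hx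
  exact h x ⟨norm_pos_iff.1 (hx' ▸ (hR i).1), hx' ▸ (hR i).2⟩

/-- The integral of a separately holomorphic function over a torus does not depend on its radii. -/
theorem SepHolo.torusIntegral_eq {ρ : ℝ} : ∀ {k : ℕ} {f : (Fin k → ℂ) → ℂ},
    SepHolo f (punctPolydisc k ρ) → ∀ {R R' : Fin k → ℝ}, (∀ j, 0 < R j ∧ R j < ρ) →
      (∀ j, 0 < R' j ∧ R' j < ρ) → torusIntegral f 0 R = torusIntegral f 0 R'
  | 0, f, _, R, R', _, _ => by rw [Subsingleton.elim R R']
  | 1, f, hf, R, R', hR, hR' => by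
      have hd : ∀ z, z ≠ 0 → ‖z‖ < ρ → DifferentiableAt ℂ (fun w => f fun _ => w) z := by
        intro z h0 h1
        convert hf.diff (fun _ => z) (fun _ => ⟨h0, h1⟩) 0 using 3 with w
        ext j
        rw [Subsingleton.elim j 0]
        simp
      rw [torusIntegral_dim1, torusIntegral_dim1]
      rcases le_total (R 0) (R' 0) with h | h
      · exact (circleIntegral_eq_of_punctured hd (hR 0).1 h (hR' 0).2).symm
      · exact circleIntegral_eq_of_punctured hd (hR' 0).1 h (hR 0).2
  | k + 2, f, hf, R, R', hR, hR' => by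
      -- The intermediate radii share coordinate `0` with `R` and coordinate `1` with `R'`. Each
      -- comparison thus freezes one variable and uses the case of dimension `k + 1`; two
      -- coordinates are needed, so dimension one is a separate base case.
      have hM : ∀ j, 0 < Function.update R' 0 (R 0) j ∧ Function.update R' 0 (R 0) j < ρ := by
        intro j
        by_cases hj : j = 0
        · subst hj; simpa using hR 0
        · simpa [hj] using hR' j
      trans torusIntegral f 0 (Function.update R' 0 (R 0))
      · refine torusIntegral_insertNth_congr hf.cont hR hM 0 (by simp) fun x hx => ?_
        exact (hf.insertNth 0 hx).torusIntegral_eq (fun j => hR _) (fun j => hM _)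
      · refine torusIntegral_insertNth_congr hf.cont hM hR' 1 (by simp) fun x hx => ?_
        exact (hf.insertNth 1 hx).torusIntegral_eq (fun j => hM _) (fun j => hR' _)

lemma torusIntegral_smul_radius {k : ℕ} (f : (Fin k → ℂ) → ℂ) (R : Fin k → ℝ) (t : ℝ) :
    torusIntegral f 0 (fun j => t * R j) =
      (t : ℂ) ^ k * torusIntegral (fun z => f fun j => t * z j) 0 R := by
  simp only [torusIntegral]
  rw [← integral_const_mul]
  congr 1
  ext θ
  have h1 : torusMap 0 (fun j => t * R j) θ = fun j => (t : ℂ) * torusMap 0 R θ j := by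
    ext j
    simp [torusMap, mul_assoc]
  have h2 : ∏ i, (((t * R i : ℝ) : ℂ) * Complex.exp (θ i * Complex.I) * Complex.I) =
      (t : ℂ) ^ k * ∏ i, ((R i : ℂ) * Complex.exp (θ i * Complex.I) * Complex.I) := by
    calc _ = ∏ i : Fin k, (t : ℂ) * ((R i : ℂ) * Complex.exp (θ i * Complex.I) * Complex.I) :=
          Finset.prod_congr rfl fun i _ => by push_cast; ring
      _ = _ := by rw [Finset.prod_mul_distrib]; simp
  rw [h1, h2, smul_eq_mul, smul_eq_mul, mul_assoc]

/-- The integral of a product of functions of one variable is the product of the integrals. -/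
lemma torusIntegral_prod {k : ℕ} (f : Fin k → ℂ → ℂ) (R : Fin k → ℝ) :
    torusIntegral (fun z => ∏ j, f j (z j)) 0 R = ∏ j, ∮ w in C(0, R j), f j w := by
  simp only [torusIntegral, circleIntegral_def_Icc]
  rw [← Set.pi_univ_Icc, volume_pi, Measure.restrict_pi_pi]
  rw [← integral_fintype_prod_eq_prod]
  congr 1
  ext θ
  rw [smul_eq_mul, ← Finset.prod_mul_distrib]
  refine Finset.prod_congr rfl fun j _ => ?_
  simp [torusMap, deriv_circleMap, circleMap]

lemma SepHolo.mono {k : ℕ} {f : (Fin k → ℂ) → ℂ} {U V : Set (Fin k → ℂ)} (hf : SepHolo f U)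
    (h : V ⊆ U) : SepHolo f V :=
  ⟨hf.cont.mono h, fun z hz => hf.diff z (h hz)⟩

lemma SepHolo.mul {k : ℕ} {f g : (Fin k → ℂ) → ℂ} {U : Set (Fin k → ℂ)} (hf : SepHolo f U)
    (hg : SepHolo g U) : SepHolo (fun z => f z * g z) U :=
  ⟨hf.cont.mul hg.cont, fun z hz j => (hf.diff z hz j).mul (hg.diff z hz j)⟩

lemma differentiable_update_apply {k : ℕ} (z : Fin k → ℂ) (j : Fin k) :
    Differentiable ℂ fun w => Function.update z j w :=
  fun _ => (hasFDerivAt_update z _).differentiableAt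

lemma sepHolo_of_differentiableAt {k : ℕ} {f : (Fin k → ℂ) → ℂ} {U : Set (Fin k → ℂ)}
    (hf : ∀ z ∈ U, DifferentiableAt ℂ f z) : SepHolo f U where
  cont z hz := (hf z hz).continuousAt.continuousWithinAt
  diff z hz j := by
    have h : DifferentiableAt ℂ f (Function.update z j (z j)) := by
      rw [Function.update_eq_self]; exact hf z hz
    exact h.comp (z j) (differentiable_update_apply z j (z j))

/-! ### Moments against a homogeneous kernel -/

/-- The torus integral of `F(z) L(z) (z_1 + ⋯ + z_k) ^ m`. -/
noncomputable def moment {k : ℕ} (F L : (Fin k → ℂ) → ℂ) (R : Fin k → ℝ) (m : ℕ) : ℂ :=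
  torusIntegral (fun z => F z * L z * (∑ j, z j) ^ m) 0 R

lemma sepHolo_sum_pow {k : ℕ} (m : ℕ) (U : Set (Fin k → ℂ)) :
    SepHolo (fun z : Fin k → ℂ => (∑ j, z j) ^ m) U :=
  sepHolo_of_differentiableAt fun z _ => by fun_prop

/-- The scaling relation for the moments of a homogeneous kernel. -/
lemma moment_scaling {k N : ℕ} {F L : (Fin k → ℂ) → ℂ} {R : Fin k → ℝ} {ρ : ℝ}
    (hF : SepHolo F (polydisc k ρ)) (hL : SepHolo L (punctPolydisc k ρ))
    (hom : ∀ t : ℝ, 0 < t → ∀ z, (t : ℂ) ^ (N + k) * L (fun j => t * z j) = L z)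
    (hR : ∀ j, 0 < R j ∧ R j < ρ) (m : ℕ) {t : ℝ} (h0 : 0 < t) (h1 : t ≤ 1) :
    (t : ℂ) ^ N * moment F L R m = t ^ m * moment (fun z => F fun j => t * z j) L R m := by
  have hs : SepHolo (fun z => F z * L z * (∑ j, z j) ^ m) (punctPolydisc k ρ) :=
    ((hF.mono (punctPolydisc_subset k ρ)).mul hL).mul (sepHolo_sum_pow m _)
  have hR' : ∀ j, 0 < t * R j ∧ t * R j < ρ := fun j =>
    ⟨mul_pos h0 (hR j).1, (mul_le_of_le_one_left (hR j).1.le h1).trans_lt (hR j).2⟩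
  rw [moment, hs.torusIntegral_eq hR hR', torusIntegral_smul_radius, moment, ← mul_assoc, ← pow_add,
    ← torusIntegral_const_mul, ← torusIntegral_const_mul]
  congr 1
  ext z
  rw [← hom t h0 z, ← Finset.mul_sum, mul_pow]
  ring

lemma tendsto_moment {k : ℕ} {F L : (Fin k → ℂ) → ℂ} {R : Fin k → ℝ} {ρ : ℝ} (hρ : 0 < ρ)
    (hF : SepHolo F (polydisc k ρ)) (hL : SepHolo L (punctPolydisc k ρ))
    (hR : ∀ j, 0 < R j ∧ R j < ρ) (m : ℕ) :
    Tendsto (fun t : ℝ => moment (fun z => F fun j => t * z j) L R m) (𝓝[>] 0)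
      (𝓝 (F 0 * moment (fun _ => 1) L R m)) := by
  have hmem : (0 : Fin k → ℂ) ∈ polydisc k ρ := fun j => by simpa using hρ
  have hc0 : ContinuousAt F 0 := hF.cont.continuousAt ((isOpen_polydisc k ρ).mem_nhds hmem)
  set K : Set (Fin k → ℝ) := Set.Icc 0 fun _ => 2 * Real.pi
  set g : (Fin k → ℝ) → ℂ := fun θ => (∏ i, (R i : ℂ) * Complex.exp (θ i * Complex.I) * Complex.I) *
    (L (torusMap 0 R θ) * (∑ j, torusMap 0 R θ j) ^ m)
  have hLc := ContinuousOn.continuous_comp_torusMap hL.cont hR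
  have hTc := continuous_torusMap (0 : Fin k → ℂ) R
  have hg : Continuous g := by
    have : ∀ j, Continuous fun θ => torusMap 0 R θ j := fun j => (continuous_apply j).comp hTc
    exact Continuous.mul (by fun_prop) (hLc.mul (by fun_prop))
  have hmom : ∀ H : (Fin k → ℂ) → ℂ, moment H L R m = ∫ θ in K, H (torusMap 0 R θ) * g θ := by
    intro H
    simp only [moment, torusIntegral, smul_eq_mul, g, K]
    congr 1
    ext θ
    ring
  have hscal : ∀ θ, ∀ t ∈ Set.Icc (0 : ℝ) 1, (fun j => (t : ℂ) * torusMap 0 R θ j) ∈ polydisc k ρ := by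
    intro θ t ht j
    have := norm_torusMap_zero (fun j => (hR j).1) θ j
    rw [norm_mul, this, Complex.norm_real, Real.norm_of_nonneg ht.1]
    exact (mul_le_of_le_one_left (hR j).1.le ht.2).trans_lt (hR j).2
  have hjoint : ContinuousOn (fun p : ℝ × (Fin k → ℝ) => F (fun j => (p.1 : ℂ) * torusMap 0 R p.2 j))
      (Set.Icc 0 1 ×ˢ K) := by
    refine hF.cont.comp ?_ fun p hp => hscal p.2 p.1 hp.1
    have : ∀ j, Continuous fun p : ℝ × (Fin k → ℝ) => torusMap 0 R p.2 j :=
      fun j => (continuous_apply j).comp (hTc.comp continuous_snd)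
    exact (continuous_pi fun j => (by fun_prop)).continuousOn
  -- Compactness in `(t, θ)` jointly, with `t = 0` included, makes the bound uniform in `t`, as
  -- dominated convergence requires.
  obtain ⟨C, hC⟩ := (isCompact_Icc.prod isCompact_Icc).exists_bound_of_continuousOn hjoint
  rw [hmom, ← integral_const_mul]
  simp only [hmom, one_mul]
  have hIoc : ∀ᶠ t : ℝ in 𝓝[>] 0, t ∈ Set.Ioc (0 : ℝ) 1 := Ioc_mem_nhdsGT one_pos
  refine tendsto_integral_filter_of_dominated_convergence (fun θ => C * ‖g θ‖) ?_ ?_ ?_ ?_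
  · filter_upwards [hIoc] with t ht
    refine Continuous.aestronglyMeasurable (Continuous.mul ?_ hg)
    have : ∀ j, Continuous fun θ => torusMap 0 R θ j := fun j => (continuous_apply j).comp hTc
    exact hF.cont.comp_continuous (continuous_pi fun j => (by fun_prop))
      fun θ => hscal θ t ⟨ht.1.le, ht.2⟩
  · filter_upwards [hIoc] with t ht
    filter_upwards [ae_restrict_mem measurableSet_Icc] with θ hθ
    rw [norm_mul]
    exact mul_le_mul_of_nonneg_right (hC (t, θ) ⟨⟨ht.1.le, ht.2⟩, hθ⟩) (norm_nonneg _)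
  · exact (by fun_prop : Continuous fun θ => C * ‖g θ‖).continuousOn.integrableOn_compact
      isCompact_Icc
  · refine Eventually.of_forall fun θ => Tendsto.mul_const _ ?_
    have h0 : (fun j => ((0 : ℝ) : ℂ) * torusMap 0 R θ j) = 0 := by ext; simp
    have : Continuous fun t : ℝ => fun j => (t : ℂ) * torusMap 0 R θ j := by fun_prop
    have h2 : ContinuousAt F (fun j => ((0 : ℝ) : ℂ) * torusMap 0 R θ j) := by rwa [h0]
    have h3 := (ContinuousAt.comp (f := fun t : ℝ => fun j => (t : ℂ) * torusMap 0 R θ j)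
      h2 this.continuousAt).tendsto
    simp only [Function.comp_def, h0] at h3
    exact h3.mono_left nhdsWithin_le_nhds

/-- The moments beyond the degree of homogeneity vanish, and the critical one only depends on
`F 0`. -/
lemma moment_add {k N : ℕ} {F L : (Fin k → ℂ) → ℂ} {R : Fin k → ℝ} {ρ : ℝ} (hρ : 0 < ρ)
    (hF : SepHolo F (polydisc k ρ)) (hL : SepHolo L (punctPolydisc k ρ))
    (hom : ∀ t : ℝ, 0 < t → ∀ z, (t : ℂ) ^ (N + k) * L (fun j => t * z j) = L z)
    (hR : ∀ j, 0 < R j ∧ R j < ρ) (d : ℕ) :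
    moment F L R (N + d) = 0 ^ d * (F 0 * moment (fun _ => 1) L R (N + d)) := by
  have h1 : Tendsto (fun t : ℝ => (t : ℂ) ^ d * moment (fun z => F fun j => t * z j) L R (N + d))
      (𝓝[>] 0) (𝓝 (((0 : ℝ) : ℂ) ^ d * (F 0 * moment (fun _ => 1) L R (N + d)))) := by
    refine Tendsto.mul ?_ (tendsto_moment hρ hF hL hR _)
    exact ((by fun_prop : Continuous fun t : ℝ => (t : ℂ) ^ d).tendsto 0).mono_left
      nhdsWithin_le_nhds
  rw [Complex.ofReal_zero] at h1
  refine tendsto_nhds_unique (tendsto_const_nhds.congr' ?_) h1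
  have hIoc : ∀ᶠ t : ℝ in 𝓝[>] 0, t ∈ Set.Ioc (0 : ℝ) 1 := Ioc_mem_nhdsGT one_pos
  filter_upwards [hIoc] with t ht
  have ht0 : (t : ℂ) ^ N ≠ 0 := pow_ne_zero _ (by exact_mod_cast ht.1.ne')
  refine mul_left_cancel₀ ht0 ?_
  rw [moment_scaling hF hL hom hR _ ht.1 ht.2, pow_add, mul_assoc]

/-- For constant `F` the scaling relation reads `t^N M = t^m M`; one value `t ≠ 1` suffices. -/
lemma moment_one_eq_zero {k N : ℕ} {L : (Fin k → ℂ) → ℂ} {R : Fin k → ℝ} {ρ : ℝ}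
    (hL : SepHolo L (punctPolydisc k ρ))
    (hom : ∀ t : ℝ, 0 < t → ∀ z, (t : ℂ) ^ (N + k) * L (fun j => t * z j) = L z)
    (hR : ∀ j, 0 < R j ∧ R j < ρ) {m : ℕ} (hm : m ≠ N) : moment (fun _ => 1) L R m = 0 := by
  have h := moment_scaling (F := fun _ => 1) (sepHolo_of_differentiableAt fun _ _ => by fun_prop)
    hL hom hR m (t := 1 / 2) (by norm_num) (by norm_num)
  rw [← sub_eq_zero, ← sub_mul, mul_eq_zero] at h
  refine h.resolve_left fun h' => hm ?_
  rw [sub_eq_zero] at h'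
  have h3 : (1 / 2 : ℝ) ^ N = (1 / 2) ^ m := by exact_mod_cast h'
  exact (pow_right_injective₀ (by norm_num) (by norm_num) h3).symm

/-- Expansion of the exponential under the integral sign. -/
lemma hasSum_moment {k : ℕ} {F L : (Fin k → ℂ) → ℂ} {R : Fin k → ℝ} {ρ : ℝ}
    (hF : SepHolo F (punctPolydisc k ρ)) (hL : SepHolo L (punctPolydisc k ρ))
    (hR : ∀ j, 0 < R j ∧ R j < ρ) (y : ℂ) :
    HasSum (fun m : ℕ => y ^ m / (m ! : ℂ) * moment F L R m)
      (torusIntegral (fun z => F z * L z * Complex.exp (y * ∑ j, z j)) 0 R) := by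
  set K : Set (Fin k → ℝ) := Set.Icc 0 fun _ => 2 * Real.pi
  set g : (Fin k → ℝ) → ℂ := fun θ => (∏ i, (R i : ℂ) * Complex.exp (θ i * Complex.I) * Complex.I) *
    (F (torusMap 0 R θ) * L (torusMap 0 R θ))
  have hLc := ContinuousOn.continuous_comp_torusMap hL.cont hR
  have hFc := ContinuousOn.continuous_comp_torusMap hF.cont hR
  have hTc := continuous_torusMap (0 : Fin k → ℂ) R
  have hT : ∀ j, Continuous fun θ => torusMap 0 R θ j := fun j => (continuous_apply j).comp hTc
  have hg : Continuous g := Continuous.mul (by fun_prop) (hFc.mul hLc)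
  obtain ⟨C, hC⟩ := (isCompact_Icc (a := (0 : Fin k → ℝ)) (b := fun _ => 2 * Real.pi)).exists_bound_of_continuousOn
    hg.continuousOn
  set B : ℝ := ‖y‖ * ∑ j, R j
  have hB : ∀ θ, ‖y * ∑ j, torusMap 0 R θ j‖ ≤ B := fun θ => by
    rw [norm_mul]
    refine mul_le_mul_of_nonneg_left ((norm_sum_le _ _).trans (le_of_eq ?_)) (norm_nonneg _)
    exact Finset.sum_congr rfl fun j _ => norm_torusMap_zero (fun j => (hR j).1) θ j
  have hB0 : 0 ≤ B := (norm_nonneg _).trans (hB 0)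
  have h := hasSum_integral_of_dominated_convergence (μ := volume.restrict K)
    (F := fun (m : ℕ) θ => g θ * ((y * ∑ j, torusMap 0 R θ j) ^ m / (m ! : ℂ)))
    (f := fun θ => g θ * Complex.exp (y * ∑ j, torusMap 0 R θ j))
    (fun m _ => C * (B ^ m / m !)) (fun m => Continuous.aestronglyMeasurable (by fun_prop))
    ?_ ?_ ?_ ?_
  · have h1 : ∀ m, y ^ m / (m ! : ℂ) * moment F L R m =
        ∫ θ in K, g θ * ((y * ∑ j, torusMap 0 R θ j) ^ m / (m ! : ℂ)) := by
      intro m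
      simp only [moment, torusIntegral, ← integral_const_mul, g, smul_eq_mul, mul_pow, K]
      congr 1
      ext θ
      ring
    have h2 : torusIntegral (fun z => F z * L z * Complex.exp (y * ∑ j, z j)) 0 R =
        ∫ θ in K, g θ * Complex.exp (y * ∑ j, torusMap 0 R θ j) := by
      simp only [torusIntegral, g, smul_eq_mul, K]
      congr 1
      ext θ
      ring
    simp only [h1, h2]
    exact h
  · intro m
    filter_upwards [ae_restrict_mem measurableSet_Icc] with θ hθ
    rw [norm_mul, norm_div, norm_pow, Complex.norm_natCast]
    have := hB θ
    exact mul_le_mul (hC θ hθ) (by gcongr) (by positivity) ((norm_nonneg _).trans (hC θ hθ))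
  · exact Eventually.of_forall fun θ => (Real.summable_pow_div_factorial B).mul_left C
  · exact (continuous_const.continuousOn (s := K)).integrableOn_compact isCompact_Icc
  · refine Eventually.of_forall fun θ => HasSum.mul_left _ ?_
    rw [Complex.exp_eq_exp_ℂ]
    exact NormedSpace.expSeries_div_hasSum_exp _

lemma torusIntegral_exp_eq_sum {k N : ℕ} {F L : (Fin k → ℂ) → ℂ} {R : Fin k → ℝ} {ρ : ℝ} (hρ : 0 < ρ)
    (hF : SepHolo F (polydisc k ρ)) (hL : SepHolo L (punctPolydisc k ρ))
    (hom : ∀ t : ℝ, 0 < t → ∀ z, (t : ℂ) ^ (N + k) * L (fun j => t * z j) = L z)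
    (hR : ∀ j, 0 < R j ∧ R j < ρ) (y : ℂ) :
    torusIntegral (fun z => F z * L z * Complex.exp (y * ∑ j, z j)) 0 R =
      ∑ m ∈ Finset.range (N + 1), y ^ m / (m ! : ℂ) * moment F L R m := by
  refine (hasSum_moment (hF.mono (punctPolydisc_subset k ρ)) hL hR y).unique
    (hasSum_sum_of_ne_finset_zero fun m hm => ?_)
  obtain ⟨d, rfl⟩ : ∃ d, m = N + d := ⟨m - N, by simp at hm; omega⟩
  have hd : d ≠ 0 := by simp at hm; omega
  rw [moment_add hρ hF hL hom hR, zero_pow hd]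
  simp

/-- With `F = 1` only the term `m = N` of the exponential series survives, so the critical moment
can be read off from a full exponential, whose integral factors over the variables. -/
lemma torusIntegral_kernel_mul_exp {k N : ℕ} {L : (Fin k → ℂ) → ℂ} {R : Fin k → ℝ} {ρ : ℝ}
    (hL : SepHolo L (punctPolydisc k ρ))
    (hom : ∀ t : ℝ, 0 < t → ∀ z, (t : ℂ) ^ (N + k) * L (fun j => t * z j) = L z)
    (hR : ∀ j, 0 < R j ∧ R j < ρ) :
    torusIntegral (fun z => L z * Complex.exp (∑ j, z j)) 0 R =
      moment (fun _ => 1) L R N / (N ! : ℂ) := by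
  have h := hasSum_moment (F := fun _ => 1) (sepHolo_of_differentiableAt fun _ _ => by fun_prop)
    hL hR 1
  simp only [one_mul] at h
  refine h.unique ?_
  convert hasSum_single N fun m hm => ?_ using 1
  · simp [div_eq_inv_mul]
  · simp [moment_one_eq_zero hL hom hR hm]

/-! ### The kernel and its determinant of inverse factorials -/

/-- The homogeneous kernel `Δ(z²) Δ(z) / ∏ z_j^(2k)`. -/
noncomputable def kernel (k : ℕ) (z : Fin k → ℂ) : ℂ :=
  vandermondeDet (fun j => z j ^ 2) * vandermondeDet z / ∏ j, z j ^ (2 * k)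

lemma differentiable_vandermondeDet (k : ℕ) :
    Differentiable ℂ (vandermondeDet : (Fin k → ℂ) → ℂ) := by
  unfold vandermondeDet
  simp only [Matrix.det_vandermonde]
  fun_prop

lemma sepHolo_kernel (k : ℕ) (ρ : ℝ) : SepHolo (kernel k) (punctPolydisc k ρ) := by
  refine sepHolo_of_differentiableAt fun z hz => ?_
  have h0 : ∏ j, z j ^ (2 * k) ≠ 0 := Finset.prod_ne_zero_iff.2 fun j _ => pow_ne_zero _ (hz j).1
  have h1 := (differentiable_vandermondeDet k) z
  have h2 : DifferentiableAt ℂ (fun z : Fin k → ℂ => vandermondeDet fun j => z j ^ 2) z :=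
    (differentiable_vandermondeDet k _).comp z (by fun_prop)
  have h3 : DifferentiableAt ℂ (fun z : Fin k → ℂ => ∏ j, z j ^ (2 * k)) z := by fun_prop
  exact (h2.mul h1).mul (h3.inv h0)

lemma det_vandermonde_mul {R : Type*} [CommRing R] {k : ℕ} (t : R) (w : Fin k → R) :
    (Matrix.vandermonde fun j => t * w j).det =
      t ^ (k * (k - 1) / 2) * (Matrix.vandermonde w).det := by
  have h := Matrix.det_mul_row (fun j : Fin k => t ^ (j : ℕ)) (Matrix.vandermonde w)
  rw [Finset.prod_pow_eq_pow_sum, Fin.sum_univ_eq_sum_range (fun i => i), Finset.sum_range_id] at h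
  rw [← h]
  congr 1
  ext i j
  simp [Matrix.vandermonde_apply, mul_pow]

lemma kernel_homogeneous (k : ℕ) (t : ℝ) (ht : 0 < t) (z : Fin k → ℂ) :
    (t : ℂ) ^ (k * (k + 1) / 2 + k) * kernel k (fun j => t * z j) = kernel k z := by
  have ht' : (t : ℂ) ≠ 0 := by exact_mod_cast ht.ne'
  obtain ⟨d, hd⟩ : ∃ d, k * (k - 1) = 2 * d := (Nat.even_mul_pred_self k).two_dvd
  obtain ⟨N, hN⟩ : ∃ N, k * (k + 1) = 2 * N := (Nat.even_mul_succ_self k).two_dvd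
  -- Degree count: `2d` from `Δ(z²)` and `d` from `Δ(z)`, against `2k·k` from the denominator.
  have e1 : N + k + (2 * d + d) = 2 * k * k := by
    rcases k with _ | k
    · simp at hd hN; omega
    · simp only [Nat.add_sub_cancel] at hd
      nlinarith
  simp only [kernel, vandermondeDet, mul_pow, det_vandermonde_mul, Finset.prod_mul_distrib,
    Finset.prod_const, Finset.card_univ, Fintype.card_fin]
  rw [hd, hN, Nat.mul_div_cancel_left _ two_pos, Nat.mul_div_cancel_left _ two_pos, ← pow_mul,
    ← pow_mul, ← e1, pow_add _ (N + k), pow_add _ (2 * d)]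
  have h1 := pow_ne_zero (2 * d) ht'
  have h2 := pow_ne_zero d ht'
  have h3 := pow_ne_zero (N + k) ht'
  rw [show ∀ a b c u v w : ℂ, a * (b * u * (c * v) / (a * (b * c) * w)) =
    (a * (b * c)) * (u * v) / ((a * (b * c)) * w) from fun a b c u v w => by ring,
    mul_div_mul_left _ _ (mul_ne_zero h3 (mul_ne_zero h1 h2))]

/-- The inverse factorial `1 / (M - 1 - n)!`, read as zero for `n ≥ M`. -/
noncomputable def invFactorial (M n : ℕ) : ℂ := if n < M then 1 / ((M - 1 - n)! : ℂ) else 0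

/-- For `n < M` this is Cauchy's formula for the derivative of `exp` of order `M - 1 - n` at `0`;
for `n ≥ M` the integrand extends to an entire function. -/
lemma circleIntegral_pow_div_pow_mul_exp (n M : ℕ) {R : ℝ} (hR : 0 < R) :
    (∮ w in C(0, R), w ^ n / w ^ M * Complex.exp w) =
      2 * Real.pi * Complex.I * invFactorial M n := by
  have hne : ∀ w ∈ Metric.sphere (0 : ℂ) R, w ≠ 0 := fun w hw =>
    ne_zero_of_mem_sphere hR.ne' ⟨w, hw⟩
  unfold invFactorial
  split_ifs with h
  · obtain ⟨d, rfl⟩ : ∃ d, M = n + (d + 1) := ⟨M - n - 1, by omega⟩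
    have h1 := (Complex.differentiable_exp.differentiableOn
      (s := Metric.closedBall 0 R)).circleIntegral_one_div_sub_center_pow_smul hR d
    rw [iteratedDeriv_eq_iterate, Complex.iter_deriv_exp] at h1
    rw [show n + (d + 1) - 1 - n = d by omega]
    simp only [sub_zero, smul_eq_mul, Complex.exp_zero] at h1
    rw [circleIntegral.integral_congr hR.le (g := fun w => 1 / w ^ (d + 1) * Complex.exp w), h1]
    · ring
    · intro w hw
      have := hne w hw
      simp only [pow_add w n]
      field_simp
  · obtain ⟨d, rfl⟩ : ∃ d, n = M + d := ⟨n - M, by omega⟩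
    rw [mul_zero, circleIntegral.integral_congr hR.le (g := fun w => w ^ d * Complex.exp w)]
    · refine DiffContOnCl.circleIntegral_eq_zero hR.le (Differentiable.diffContOnCl (by fun_prop))
    · intro w hw
      have := hne w hw
      simp only [pow_add w M]
      field_simp

lemma torusIntegral_finset_sum {k : ℕ} {ι : Type*} (s : Finset ι) (f : ι → (Fin k → ℂ) → ℂ)
    {R : Fin k → ℝ} (hf : ∀ i ∈ s, TorusIntegrable (f i) 0 R) :
    torusIntegral (fun z => ∑ i ∈ s, f i z) 0 R = ∑ i ∈ s, torusIntegral (f i) 0 R := by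
  simp only [torusIntegral, Finset.smul_sum]
  exact integral_finsetSum _ fun i hi => (hf i hi).function_integrable

/-- For fixed `σ` the sum over `τ` is `sign σ` times the determinant of a row permutation of `A`,
hence `det A`; there are `k!` choices of `σ`. -/
lemma sum_perm_perm_eq_factorial_mul_det {k : ℕ} (A : Matrix (Fin k) (Fin k) ℂ) :
    ∑ σ : Equiv.Perm (Fin k), ∑ τ : Equiv.Perm (Fin k),
      ((Equiv.Perm.sign σ : ℤ) : ℂ) * ((Equiv.Perm.sign τ : ℤ) : ℂ) * ∏ i, A (σ i) (τ i) =
      (k ! : ℂ) * A.det := by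
  have h : ∀ σ : Equiv.Perm (Fin k), ∑ τ : Equiv.Perm (Fin k),
      ((Equiv.Perm.sign σ : ℤ) : ℂ) * ((Equiv.Perm.sign τ : ℤ) : ℂ) * ∏ i, A (σ i) (τ i) =
      A.det := by
    intro σ
    have h1 := Matrix.det_permute σ A
    rw [← Matrix.det_transpose, Matrix.det_apply'] at h1
    simp only [Matrix.transpose_apply, Matrix.submatrix_apply, id] at h1
    simp only [mul_assoc, ← Finset.mul_sum]
    rw [h1, ← mul_assoc, ← Int.cast_mul, Int.units_coe_mul_self, Int.cast_one, one_mul]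
  rw [Finset.sum_congr rfl fun σ _ => h σ]
  simp [Fintype.card_perm]

lemma torusIntegral_kernel_exp_eq_det (k : ℕ) {R : Fin k → ℝ} {ρ : ℝ}
    (hR : ∀ j, 0 < R j ∧ R j < ρ) :
    torusIntegral (fun z => kernel k z * Complex.exp (∑ j, z j)) 0 R =
      (2 * Real.pi * Complex.I) ^ k * ((k ! : ℂ) *
        (Matrix.of fun i j : Fin k => invFactorial (2 * k) (2 * i + j)).det) := by
  set T : (σ τ : Equiv.Perm (Fin k)) → (Fin k → ℂ) → ℂ := fun σ τ z =>
    ((Equiv.Perm.sign σ : ℤ) : ℂ) * ((Equiv.Perm.sign τ : ℤ) : ℂ) *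
      ∏ j, (z j ^ (2 * (σ j : ℕ) + (τ j : ℕ)) / z j ^ (2 * k) * Complex.exp (z j))
  have hT : ∀ z, kernel k z * Complex.exp (∑ j, z j) =
      ∑ p : Equiv.Perm (Fin k) × Equiv.Perm (Fin k), T p.1 p.2 z := by
    intro z
    rw [Fintype.sum_prod_type, kernel, vandermondeDet, vandermondeDet, ← Matrix.det_transpose,
      ← Matrix.det_transpose (Matrix.vandermonde z), Matrix.det_apply', Matrix.det_apply',
      Finset.sum_mul_sum, Finset.sum_div, Finset.sum_mul, Complex.exp_sum]
    refine Finset.sum_congr rfl fun σ _ => ?_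
    rw [Finset.sum_div, Finset.sum_mul]
    refine Finset.sum_congr rfl fun τ _ => ?_
    simp only [T, Matrix.transpose_apply, Matrix.vandermonde_apply, pow_add, pow_mul,
      Finset.prod_mul_distrib, Finset.prod_div_distrib]
    ring
  have hint : ∀ p ∈ (Finset.univ : Finset (Equiv.Perm (Fin k) × Equiv.Perm (Fin k))),
      TorusIntegrable (T p.1 p.2) 0 R := by
    intro p _
    refine ContinuousOn.torusIntegrable (ρ := ρ) (fun z hz => ?_) hR
    refine ContinuousAt.continuousWithinAt (continuousAt_const.mul ?_)
    refine tendsto_finsetProd _ fun j _ => ?_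
    have h1 : ContinuousAt (fun z : Fin k → ℂ => z j) z := (continuous_apply j).continuousAt
    exact ((h1.pow _).div (h1.pow _) (pow_ne_zero _ (hz j).1)).mul
      (Complex.continuous_exp.continuousAt.comp h1)
  simp only [hT]
  rw [torusIntegral_finset_sum _ (fun p : Equiv.Perm (Fin k) × Equiv.Perm (Fin k) => T p.1 p.2)
    hint, Fintype.sum_prod_type, ← sum_perm_perm_eq_factorial_mul_det, Finset.mul_sum]
  refine Finset.sum_congr rfl fun σ _ => ?_
  rw [Finset.mul_sum]
  refine Finset.sum_congr rfl fun τ _ => ?_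
  simp only [T]
  rw [torusIntegral_const_mul, torusIntegral_prod (fun j w =>
    w ^ (2 * (σ j : ℕ) + (τ j : ℕ)) / w ^ (2 * k) * Complex.exp w)]
  simp only [circleIntegral_pow_div_pow_mul_exp _ _ (hR _).1, Finset.prod_mul_distrib,
    Finset.prod_const, Finset.card_univ, Fintype.card_fin, Matrix.of_apply]
  ring

lemma det_vandermonde_natCast (k : ℕ) :
    (Matrix.vandermonde fun i : Fin k => ((i : ℕ) : ℂ)).det = ∏ j ∈ Finset.range k, (j ! : ℂ) := by
  rcases k with _ | k
  · simp
  · rw [Matrix.det_vandermonde_id_eq_superFactorial, ← Nat.prod_range_succ_factorial, Nat.cast_prod]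

/-- Both sides are `∏_{j<2k} j!`, split into halves on the left and by parity on the right. -/
lemma prod_factorial_mul_prod_factorial (k : ℕ) :
    (∏ j ∈ Finset.range k, j !) * ∏ j ∈ Finset.range k, (k + j)! =
      (∏ j ∈ Finset.range k, (2 * j)!) * ∏ j ∈ Finset.range k, (2 * j + 1)! := by
  rw [← Finset.prod_range_add, ← two_mul]
  induction k with
  | zero => simp
  | succ k ih =>
    rw [show 2 * (k + 1) = 2 * k + 1 + 1 by ring, Finset.prod_range_succ, Finset.prod_range_succ, ih,
      Finset.prod_range_succ, Finset.prod_range_succ]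
    ring

lemma det_invFactorial (k : ℕ) :
    (Matrix.of fun i j : Fin k => invFactorial (2 * k) (2 * i + j)).det =
      (-2) ^ (k * (k - 1) / 2) *
        ∏ j ∈ Finset.range k, (((2 * j)! : ℕ) : ℂ) / (((k + j)! : ℕ) : ℂ) := by
  -- With `M = 2k-1-2i`, use `1/(M-j)! = M(M-1)⋯(M-j+1)/M!`. The falling factorial vanishes for `j >
  -- M`, matching the convention in `invFactorial`. It is monic of degree `j` in `M`, so a
  -- Vandermonde determinant remains.
  have h1 : (Matrix.of fun i j : Fin k => invFactorial (2 * k) (2 * i + j)) =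
      Matrix.of fun i j : Fin k => (((2 * k - 1 - 2 * i)! : ℕ) : ℂ)⁻¹ *
        (Matrix.of fun i j : Fin k =>
          (descPochhammer ℂ j).eval (((2 * k - 1 - 2 * i : ℕ) : ℂ))) i j := by
    ext i j
    have hi := i.2
    simp only [Matrix.of_apply, descPochhammer_eval_eq_descFactorial, invFactorial]
    split_ifs with h
    · have h2 : (j : ℕ) ≤ 2 * k - 1 - 2 * i := by omega
      have h3 := Nat.factorial_mul_descFactorial h2
      rw [← h3, show 2 * k - 1 - (2 * (i : ℕ) + j) = 2 * k - 1 - 2 * i - j by omega]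
      have h4 : ((2 * k - 1 - 2 * i - j : ℕ)! : ℂ) ≠ 0 := by exact_mod_cast Nat.factorial_ne_zero _
      have h5 : ((2 * k - 1 - 2 * i : ℕ).descFactorial j : ℂ) ≠ 0 := by
        rw [Nat.cast_ne_zero, ne_eq, Nat.descFactorial_eq_zero_iff_lt]
        omega
      push_cast
      field_simp
    · rw [(Nat.descFactorial_eq_zero_iff_lt).2 (by omega)]
      simp
  rw [h1, Matrix.det_mul_column, ← Matrix.det_eval_matrixOfPolynomials_eq_det_vandermonde _
    (fun j : Fin k => descPochhammer ℂ j) (fun j => descPochhammer_natDegree ℂ j)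
    fun j => monic_descPochhammer ℂ j]
  -- The nodes form an arithmetic progression of difference `-2`: translation has no effect, and
  -- scaling yields `(-2)^{k(k-1)/2}`.
  have h2 : (fun i : Fin k => ((2 * k - 1 - 2 * i : ℕ) : ℂ)) =
      fun i : Fin k => (-2) * ((i : ℕ) : ℂ) + (2 * k - 1) := by
    ext i
    have hi := i.2
    rw [Nat.cast_sub (by omega), Nat.cast_sub (by omega)]
    push_cast
    ring
  rw [h2, Matrix.det_vandermonde_add, det_vandermonde_mul, det_vandermonde_natCast,
    Fin.prod_univ_eq_prod_range (fun i => (((2 * k - 1 - 2 * i)! : ℕ) : ℂ)⁻¹),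
    ← Finset.prod_range_reflect]
  have h3 : ∏ j ∈ Finset.range k, (((2 * k - 1 - 2 * (k - 1 - j))! : ℕ) : ℂ)⁻¹ =
      (∏ j ∈ Finset.range k, (((2 * j + 1)! : ℕ) : ℂ))⁻¹ := by
    rw [← Finset.prod_inv_distrib]
    refine Finset.prod_congr rfl fun j hj => ?_
    have := Finset.mem_range.1 hj
    rw [show 2 * k - 1 - 2 * (k - 1 - j) = 2 * j + 1 by omega]
  have h4 : (∏ j ∈ Finset.range k, (j ! : ℂ)) * ∏ j ∈ Finset.range k, ((k + j)! : ℂ) =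
      (∏ j ∈ Finset.range k, ((2 * j)! : ℂ)) * ∏ j ∈ Finset.range k, ((2 * j + 1)! : ℂ) := by
    exact_mod_cast prod_factorial_mul_prod_factorial k
  have n1 : ∏ j ∈ Finset.range k, ((k + j)! : ℂ) ≠ 0 :=
    Finset.prod_ne_zero_iff.2 fun j _ => by exact_mod_cast Nat.factorial_ne_zero _
  have n2 : ∏ j ∈ Finset.range k, ((2 * j + 1)! : ℂ) ≠ 0 :=
    Finset.prod_ne_zero_iff.2 fun j _ => by exact_mod_cast Nat.factorial_ne_zero _
  rw [h3, Finset.prod_div_distrib, mul_left_comm]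
  congr 1
  field_simp
  rw [mul_comm] at h4 ⊢
  linear_combination h4

/-! ### Estimates for the local factors -/

section Bounds

variable {ι : Type*} {x : ℝ}

lemma norm_prod_one_add_le {s : Finset ι} {f : ι → ℂ} (h1 : x ≤ 1) (hf : ∀ i ∈ s, ‖f i‖ ≤ x) :
    ‖∏ i ∈ s, (1 + f i)‖ ≤ 2 ^ s.card := by
  rw [norm_prod]
  refine (Finset.prod_le_prod (g := fun _ => (2 : ℝ)) (fun _ _ => norm_nonneg _) fun i hi =>
    (norm_add_le _ _).trans ?_).trans (by simp)
  have := hf i hi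
  rw [norm_one]
  linarith

lemma norm_prod_one_add_sub_one_le {s : Finset ι} {f : ι → ℂ} (h0 : 0 ≤ x) (h1 : x ≤ 1)
    (hf : ∀ i ∈ s, ‖f i‖ ≤ x) : ‖∏ i ∈ s, (1 + f i) - 1‖ ≤ 2 ^ s.card * x := by
  classical
  induction s using Finset.induction_on with
  | empty => simpa using h0
  | insert a s ha ih =>
    have hs : ∀ i ∈ s, ‖f i‖ ≤ x := fun i hi => hf i (Finset.mem_insert_of_mem hi)
    rw [Finset.prod_insert ha, Finset.card_insert_of_notMem ha]
    calc ‖(1 + f a) * ∏ i ∈ s, (1 + f i) - 1‖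
        = ‖(∏ i ∈ s, (1 + f i) - 1) + f a * ∏ i ∈ s, (1 + f i)‖ := by congr 1; ring
      _ ≤ 2 ^ s.card * x + x * 2 ^ s.card := by
        refine (norm_add_le _ _).trans (add_le_add (ih hs) ?_)
        rw [norm_mul]
        exact mul_le_mul (hf a (Finset.mem_insert_self _ _)) (norm_prod_one_add_le h1 hs)
          (norm_nonneg _) h0
      _ = _ := by ring

lemma norm_prod_one_add_sub_linear_le {s : Finset ι} {f : ι → ℂ} (h0 : 0 ≤ x) (h1 : x ≤ 1)
    (hf : ∀ i ∈ s, ‖f i‖ ≤ x) :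
    ‖∏ i ∈ s, (1 + f i) - 1 - ∑ i ∈ s, f i‖ ≤ 4 ^ s.card * x ^ 2 := by
  classical
  induction s using Finset.induction_on with
  | empty => simpa using sq_nonneg x
  | insert a s ha ih =>
    have hs : ∀ i ∈ s, ‖f i‖ ≤ x := fun i hi => hf i (Finset.mem_insert_of_mem hi)
    rw [Finset.prod_insert ha, Finset.sum_insert ha, Finset.card_insert_of_notMem ha]
    calc ‖(1 + f a) * ∏ i ∈ s, (1 + f i) - 1 - (f a + ∑ i ∈ s, f i)‖
        = ‖(∏ i ∈ s, (1 + f i) - 1 - ∑ i ∈ s, f i) + f a * (∏ i ∈ s, (1 + f i) - 1)‖ := by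
          congr 1; ring
      _ ≤ 4 ^ s.card * x ^ 2 + x * (4 ^ s.card * x) := by
        refine (norm_add_le _ _).trans (add_le_add (ih hs) ?_)
        rw [norm_mul]
        refine mul_le_mul (hf a (Finset.mem_insert_self _ _))
          ((norm_prod_one_add_sub_one_le h0 h1 hs).trans ?_) (norm_nonneg _) h0
        gcongr
        norm_num
      _ ≤ _ := by
        have : 0 ≤ (4 : ℝ) ^ s.card * x ^ 2 := by positivity
        rw [pow_succ (4 : ℝ)]
        nlinarith

/-- The sum of `f i * f j` over `i < j`. -/
noncomputable def pairSum {k : ℕ} (f : Fin k → ℂ) : ℂ := ∑ i, ∑ j ∈ Finset.Ioi i, f i * f j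

lemma pairSum_neg {k : ℕ} (f : Fin k → ℂ) : pairSum (fun i => -f i) = pairSum f := by
  simp [pairSum]

lemma pairSum_succ {k : ℕ} (f : Fin (k + 1) → ℂ) :
    pairSum f = f 0 * ∑ i : Fin k, f i.succ + pairSum fun i : Fin k => f i.succ := by
  rw [pairSum, Fin.sum_univ_succ, pairSum, Fin.sum_Ioi_zero, Finset.mul_sum]
  simp only [Fin.sum_Ioi_succ]

lemma norm_pairSum_le {k : ℕ} {f : Fin k → ℂ} (h0 : 0 ≤ x) (hf : ∀ i, ‖f i‖ ≤ x) :
    ‖pairSum f‖ ≤ k ^ 2 * x ^ 2 := by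
  have h1 : ∀ i : Fin k, ‖∑ j ∈ Finset.Ioi i, f i * f j‖ ≤ k * x ^ 2 := by
    intro i
    refine (norm_sum_le (Finset.Ioi i) fun j => f i * f j).trans ?_
    refine (Finset.sum_le_card_nsmul _ _ (x ^ 2) fun j _ => ?_).trans ?_
    · rw [norm_mul, sq]
      exact mul_le_mul (hf i) (hf j) (norm_nonneg _) h0
    · rw [nsmul_eq_mul]
      gcongr
      simpa using Finset.card_le_univ (Finset.Ioi i)
  refine (norm_sum_le_of_le _ fun i _ => h1 i).trans (le_of_eq ?_)
  simp
  ring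

lemma norm_prod_one_add_sub_quadratic_le {k : ℕ} {f : Fin k → ℂ} (h0 : 0 ≤ x) (h1 : x ≤ 1)
    (hf : ∀ i, ‖f i‖ ≤ x) :
    ‖∏ i, (1 + f i) - 1 - ∑ i, f i - pairSum f‖ ≤ 8 ^ k * x ^ 3 := by
  induction k with
  | zero => simp [pairSum]; positivity
  | succ k ih =>
    have h := ih (f := fun i => f i.succ) fun i => hf _
    have h' := norm_prod_one_add_sub_linear_le (s := (Finset.univ : Finset (Fin k)))
      (f := fun i => f i.succ) h0 h1 fun i _ => hf _
    rw [Finset.card_univ, Fintype.card_fin] at h'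
    rw [pairSum_succ, Fin.prod_univ_succ, Fin.sum_univ_succ]
    set P := ∏ i : Fin k, (1 + f i.succ)
    set S := ∑ i : Fin k, f i.succ
    set E := pairSum fun i : Fin k => f i.succ
    calc ‖(1 + f 0) * P - 1 - (f 0 + S) - (f 0 * S + E)‖
        = ‖(P - 1 - S - E) + f 0 * (P - 1 - S)‖ := by congr 1; ring
      _ ≤ 8 ^ k * x ^ 3 + x * (8 ^ k * x ^ 2) := by
        refine (norm_add_le _ _).trans (add_le_add h ?_)
        rw [norm_mul]
        refine mul_le_mul (hf 0) (h'.trans ?_) (norm_nonneg _) h0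
        gcongr
        norm_num
      _ ≤ _ := by
        have : 0 ≤ (8 : ℝ) ^ k * x ^ 3 := by positivity
        rw [pow_succ (8 : ℝ)]
        nlinarith

/-- Averaging over `q` and `-q` removes the linear terms and keeps `pairSum`. -/
lemma norm_even_part_sub_le {k : ℕ} {q : Fin k → ℂ} (h0 : 0 ≤ x) (h1 : x ≤ 1)
    (hq : ∀ i, ‖q i‖ ≤ x) :
    ‖1 / 2 * (∏ i, (1 + q i) + ∏ i, (1 - q i)) - (1 + pairSum q)‖ ≤ 8 ^ k * x ^ 3 := by
  have e1 := norm_prod_one_add_sub_quadratic_le h0 h1 hq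
  have e2 := norm_prod_one_add_sub_quadratic_le (f := fun i => -q i) h0 h1 (by simpa using hq)
  rw [pairSum_neg] at e2
  simp only [← sub_eq_add_neg, Finset.sum_neg_distrib] at e2
  calc _ = ‖1 / 2 * ((∏ i, (1 + q i) - 1 - ∑ i, q i - pairSum q) +
          (∏ i, (1 - q i) - 1 - -∑ i, q i - pairSum q))‖ := by congr 1; ring
    _ ≤ 1 / 2 * (8 ^ k * x ^ 3 + 8 ^ k * x ^ 3) := by
      rw [norm_mul]
      refine mul_le_mul (by norm_num) ((norm_add_le _ _).trans (add_le_add e1 e2))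
        (norm_nonneg _) (by norm_num)
    _ = _ := by ring

lemma norm_prod_pairs_sub_le {k : ℕ} {q : Fin k → ℂ} (h0 : 0 ≤ x) (h1 : x ≤ 1)
    (hq : ∀ i, ‖q i‖ ≤ x) :
    ‖∏ i, ∏ j ∈ Finset.Ioi i, (1 - q i * q j) - (1 - pairSum q)‖ ≤ 4 ^ (k * k) * x ^ 3 := by
  have h2 : x ^ 2 ≤ 1 := pow_le_one₀ h0 h1
  have h := norm_prod_one_add_sub_linear_le
    (s := (Finset.univ : Finset (Fin k)).sigma fun i => Finset.Ioi i)
    (f := fun p => -(q p.1 * q p.2)) (sq_nonneg x) h2 fun p _ => by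
      rw [norm_neg, norm_mul, sq]
      exact mul_le_mul (hq _) (hq _) (norm_nonneg _) h0
  rw [Finset.prod_sigma, Finset.sum_sigma] at h
  have hc : ((Finset.univ : Finset (Fin k)).sigma fun i => Finset.Ioi i).card ≤ k * k := by
    refine (Finset.card_le_univ _).trans (le_of_eq ?_)
    simp
  calc _ = ‖∏ i, ∏ j ∈ Finset.Ioi i, (1 + -(q i * q j)) - 1 -
          ∑ i, ∑ j ∈ Finset.Ioi i, -(q i * q j)‖ := by
        simp only [Finset.sum_neg_distrib, ← sub_eq_add_neg, pairSum]
        congr 1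
        ring
    _ ≤ _ := h
    _ ≤ _ := by
      refine mul_le_mul (pow_le_pow_right₀ (by norm_num) hc) ?_ (by positivity) (by positivity)
      rw [← pow_mul]
      exact pow_le_pow_of_le_one h0 h1 (by norm_num)

/-- The two factors are `1 - E` and `1 + E` up to `O(x³)`, with `E = pairSum q = O(x²)`, so the
second-order terms cancel and only `E² = O(x⁴)` is left. -/
lemma norm_prod_pairs_mul_even_part_sub_one_le {k : ℕ} {q : Fin k → ℂ} (h0 : 0 ≤ x) (h1 : x ≤ 1)
    (hq : ∀ i, ‖q i‖ ≤ x) :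
    ‖(∏ i, ∏ j ∈ Finset.Ioi i, (1 - q i * q j)) *
        (1 / 2 * (∏ i, (1 + q i) + ∏ i, (1 - q i))) - 1‖ ≤
      (4 ^ (k * k) * 2 ^ k + (1 + k ^ 2) * 8 ^ k + k ^ 4) * x ^ 3 := by
  have hE := norm_pairSum_le h0 hq
  have hB := norm_prod_pairs_sub_le h0 h1 hq
  have hH := norm_even_part_sub_le h0 h1 hq
  set B := ∏ i, ∏ j ∈ Finset.Ioi i, (1 - q i * q j)
  set H := 1 / 2 * (∏ i, (1 + q i) + ∏ i, (1 - q i)) with hHdef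
  set E := pairSum q
  have h2 : x ^ 2 ≤ 1 := pow_le_one₀ h0 h1
  have hH2 : ‖H‖ ≤ 2 ^ k := by
    have a1 := norm_prod_one_add_le (s := Finset.univ) h1 fun i _ => hq i
    have a2 := norm_prod_one_add_le (s := Finset.univ) (f := fun i => -q i) h1
      fun i _ => by simpa using hq i
    simp only [← sub_eq_add_neg, Finset.card_univ, Fintype.card_fin] at a1 a2
    rw [hHdef, norm_mul]
    have := norm_add_le (∏ i, (1 + q i)) (∏ i, (1 - q i))
    have h3 : ‖(1 / 2 : ℂ)‖ = 1 / 2 := by norm_num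
    rw [h3]
    linarith
  have hE1 : ‖1 - E‖ ≤ 1 + k ^ 2 := by
    refine (norm_sub_le _ _).trans ?_
    rw [norm_one]
    have : (k : ℝ) ^ 2 * x ^ 2 ≤ k ^ 2 * 1 := by gcongr
    linarith
  have hE2 : ‖E * E‖ ≤ k ^ 4 * x ^ 3 := by
    rw [norm_mul]
    calc _ ≤ (k ^ 2 * x ^ 2) * (k ^ 2 * x ^ 2) := mul_self_le_mul_self (norm_nonneg _) hE
      _ = k ^ 4 * x ^ 4 := by ring
      _ ≤ _ := mul_le_mul_of_nonneg_left (pow_le_pow_of_le_one h0 h1 (by norm_num)) (by positivity)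
  calc _ = ‖(B - (1 - E)) * H + (1 - E) * (H - (1 + E)) - E * E‖ := by congr 1; ring
    _ ≤ (4 ^ (k * k) * x ^ 3) * 2 ^ k + (1 + k ^ 2) * (8 ^ k * x ^ 3) + k ^ 4 * x ^ 3 := by
      refine (norm_sub_le _ _).trans (add_le_add ((norm_add_le _ _).trans (add_le_add ?_ ?_)) hE2)
      · rw [norm_mul]
        exact mul_le_mul hB hH2 (norm_nonneg _) (by positivity)
      · rw [norm_mul]
        exact mul_le_mul hE1 hH (norm_nonneg _) (by positivity)
    _ = _ := by ring

/-- The diagonal factors `1 - q_i²` clear the denominators of both products of geometric series. -/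
lemma prod_Ici_eq {k : ℕ} (q : Fin k → ℂ) :
    ∏ i, ∏ j ∈ Finset.Ici i, (1 - q i * q j) =
      (∏ i, ∏ j ∈ Finset.Ioi i, (1 - q i * q j)) * ((∏ i, (1 - q i)) * ∏ i, (1 + q i)) := by
  simp only [← Finset.mul_prod_Ioi_eq_prod_Ici, Finset.prod_mul_distrib]
  rw [mul_comm, ← Finset.prod_mul_distrib (f := fun i => 1 - q i)]
  congr 1
  exact Finset.prod_congr rfl fun i _ => by ring

/-- The local factors of the Euler product are `1 + O(x³)` when the local parameters are `O(x)`. -/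
lemma exists_norm_local_sub_one_le (k : ℕ) : ∃ C : ℝ, ∀ (q : Fin k → ℂ) (x v : ℝ), 0 ≤ v → v ≤ x →
    x < 1 → (∀ i, ‖q i‖ ≤ x) →
    ‖(∏ i, ∏ j ∈ Finset.Ici i, (1 - q i * q j)) *
      (1 / 2 * (∏ j, (1 - q j)⁻¹ + ∏ j, (1 + q j)⁻¹) + v) * (1 + (v : ℂ))⁻¹ - 1‖ ≤ C * x ^ 3 := by
  refine ⟨(4 ^ (k * k) * 2 ^ k + (1 + k ^ 2) * 8 ^ k + k ^ 4) + 2 ^ (k * k),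
    fun q x v hv hvx hx hq => ?_⟩
  have h0 : 0 ≤ x := hv.trans hvx
  have hBH := norm_prod_pairs_mul_even_part_sub_one_le h0 hx.le hq
  have hm : ∏ i, (1 - q i) ≠ 0 := Finset.prod_ne_zero_iff.2 fun i _ h => by
    have := hq i
    rw [← sub_eq_zero.1 h, norm_one] at this
    linarith
  have hp : ∏ i, (1 + q i) ≠ 0 := Finset.prod_ne_zero_iff.2 fun i _ h => by
    have := hq i
    rw [eq_neg_of_add_eq_zero_right h, norm_neg, norm_one] at this
    linarith
  have hA : ‖∏ i, ∏ j ∈ Finset.Ici i, (1 - q i * q j) - 1‖ ≤ 2 ^ (k * k) * x ^ 2 := by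
    have h := norm_prod_one_add_sub_one_le
      (s := (Finset.univ : Finset (Fin k)).sigma fun i => Finset.Ici i)
      (f := fun p => -(q p.1 * q p.2)) (sq_nonneg x) (pow_le_one₀ h0 hx.le) fun p _ => by
        rw [norm_neg, norm_mul, sq]
        exact mul_le_mul (hq _) (hq _) (norm_nonneg _) h0
    rw [Finset.prod_sigma] at h
    simp only [← sub_eq_add_neg] at h
    have hc : ((Finset.univ : Finset (Fin k)).sigma fun i => Finset.Ici i).card ≤ k * k := by
      refine (Finset.card_le_univ _).trans (le_of_eq ?_)
      simp
    exact h.trans (mul_le_mul_of_nonneg_right (pow_le_pow_right₀ (by norm_num) hc) (sq_nonneg x))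
  have hv1 : (1 + (v : ℂ)) ≠ 0 := by
    have : (1 + v : ℝ) ≠ 0 := by positivity
    exact_mod_cast this
  have hv2 : 1 ≤ ‖1 + (v : ℂ)‖ := by
    rw [← Complex.ofReal_one, ← Complex.ofReal_add, Complex.norm_real,
      Real.norm_of_nonneg (by positivity)]
    linarith
  have hAB := prod_Ici_eq q
  set A := ∏ i, ∏ j ∈ Finset.Ici i, (1 - q i * q j)
  set B := ∏ i, ∏ j ∈ Finset.Ioi i, (1 - q i * q j)
  -- Subtracting `1 = (1 + v)/(1 + v)` pairs the extra `v` with `A - 1 = O(x²)`, so it costs only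
  -- `O(x³)`.
  calc _ = ‖((B * (1 / 2 * (∏ i, (1 + q i) + ∏ i, (1 - q i))) - 1) + v * (A - 1)) /
          (1 + (v : ℂ))‖ := by
        congr 1
        rw [Finset.prod_inv_distrib, Finset.prod_inv_distrib, hAB]
        field_simp
        ring
    _ ≤ ‖(B * (1 / 2 * (∏ i, (1 + q i) + ∏ i, (1 - q i))) - 1) + v * (A - 1)‖ := by
        rw [norm_div]
        exact div_le_self (norm_nonneg _) hv2
    _ ≤ (4 ^ (k * k) * 2 ^ k + (1 + k ^ 2) * 8 ^ k + k ^ 4) * x ^ 3 + x * (2 ^ (k * k) * x ^ 2) := by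
        refine (norm_add_le _ _).trans (add_le_add hBH ?_)
        rw [norm_mul, Complex.norm_real, Real.norm_of_nonneg hv]
        exact mul_le_mul hvx hA (norm_nonneg _) h0
    _ = _ := by ring

end Bounds

/-! ### Convergence, holomorphy and nonvanishing of the Euler product -/

lemma prime_cast_ne_zero (p : Nat.Primes) : ((p : ℕ) : ℂ) ≠ 0 := by
  exact_mod_cast p.2.ne_zero

lemma norm_one_div_prime_cpow_le {p : Nat.Primes} {w : ℂ} (hw : ‖w‖ < 1 / 12) :
    ‖1 / ((p : ℕ) : ℂ) ^ (1 / 2 + w)‖ ≤ ((p : ℕ) : ℝ) ^ (-(5 / 12) : ℝ) := by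
  have h1 : (1 : ℝ) ≤ (p : ℕ) := by exact_mod_cast p.2.one_lt.le
  rw [one_div, ← Complex.cpow_neg, Complex.norm_natCast_cpow_of_pos p.2.pos]
  refine Real.rpow_le_rpow_of_exponent_le h1 ?_
  have := (abs_le.1 (Complex.abs_re_le_norm w)).1
  simp
  linarith

lemma prime_rpow_lt_one (p : Nat.Primes) : ((p : ℕ) : ℝ) ^ (-(5 / 12) : ℝ) < 1 :=
  Real.rpow_lt_one_of_one_lt_of_neg (by exact_mod_cast p.2.one_lt) (by norm_num)

lemma exists_norm_eulerFactor_sub_one_le (k : ℕ) : ∃ C : ℝ, ∀ z ∈ polydisc k (1 / 12),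
    ∀ p : Nat.Primes, ‖eulerFactor k z p - 1‖ ≤ C * ((p : ℕ) : ℝ) ^ (-(5 / 4) : ℝ) := by
  obtain ⟨C, hC⟩ := exists_norm_local_sub_one_le k
  refine ⟨C, fun z hz p => ?_⟩
  have h1 : (1 : ℝ) ≤ (p : ℕ) := by exact_mod_cast p.2.one_lt.le
  -- Here `x = p^{-5/12}`, since `Re(1/2 + z_j) > 5/12` for `|z_j| < 1/12`; then `x³ = p^{-5/4}` is
  -- summable over primes.
  have h := hC (fun j => 1 / ((p : ℕ) : ℂ) ^ (1 / 2 + z j)) (((p : ℕ) : ℝ) ^ (-(5 / 12) : ℝ))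
    (1 / (p : ℕ)) (by positivity) ?_ (prime_rpow_lt_one p)
    fun j => norm_one_div_prime_cpow_le (hz j)
  · rw [← Real.rpow_natCast, ← Real.rpow_mul (by positivity)] at h
    convert h using 2
    · rw [eulerFactor]
      congr 2
      · push_cast
        congr 1
        refine Finset.prod_congr rfl fun i _ => Finset.prod_congr rfl fun j _ => ?_
        rw [div_mul_div_comm, ← Complex.cpow_add _ _ (prime_cast_ne_zero p)]
        ring_nf
      · push_cast
        rfl
    · norm_num
  · rw [one_div, ← Real.rpow_neg_one]
    exact Real.rpow_le_rpow_of_exponent_le h1 (by norm_num)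

lemma summable_prime_rpow (C : ℝ) :
    Summable fun p : Nat.Primes => C * ((p : ℕ) : ℝ) ^ (-(5 / 4) : ℝ) :=
  (Nat.Primes.summable_rpow.2 (by norm_num)).mul_left C

lemma summable_norm_eulerFactor_sub_one {k : ℕ} {z : Fin k → ℂ} (hz : z ∈ polydisc k (1 / 12)) :
    Summable fun p : Nat.Primes => ‖eulerFactor k z p - 1‖ := by
  obtain ⟨C, hC⟩ := exists_norm_eulerFactor_sub_one_le k
  exact (summable_prime_rpow C).of_nonneg_of_le (fun _ => norm_nonneg _) (hC z hz)

lemma differentiableAt_eulerFactor {k : ℕ} {z : Fin k → ℂ} (hz : z ∈ polydisc k (1 / 12))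
    (p : Nat.Primes) : DifferentiableAt ℂ (fun z => eulerFactor k z p) z := by
  have hp := prime_cast_ne_zero p
  have hd : ∀ e : (Fin k → ℂ) → ℂ, DifferentiableAt ℂ e z →
      DifferentiableAt ℂ (fun z => 1 / ((p : ℕ) : ℂ) ^ e z) z := by
    intro e he
    simp only [one_div, ← Complex.cpow_neg]
    exact he.neg.const_cpow (Or.inl hp)
  have hlt : ∀ j, ‖1 / ((p : ℕ) : ℂ) ^ (1 / 2 + z j)‖ < 1 := fun j =>
    (norm_one_div_prime_cpow_le (hz j)).trans_lt (prime_rpow_lt_one p)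
  have hm : ∀ j, DifferentiableAt ℂ (fun z : Fin k → ℂ =>
      (1 - 1 / ((p : ℕ) : ℂ) ^ (1 / 2 + z j))⁻¹) z := fun j => by
    refine ((hd _ (by fun_prop)).const_sub 1).inv fun h => ?_
    have := hlt j
    rw [← sub_eq_zero.1 h, norm_one] at this
    exact lt_irrefl _ this
  have hpl : ∀ j, DifferentiableAt ℂ (fun z : Fin k → ℂ =>
      (1 + 1 / ((p : ℕ) : ℂ) ^ (1 / 2 + z j))⁻¹) z := fun j => by
    refine ((hd _ (by fun_prop)).const_add 1).inv fun h => ?_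
    have := hlt j
    rw [eq_neg_of_add_eq_zero_right h, norm_neg, norm_one] at this
    exact lt_irrefl _ this
  have ha : ∀ i j : Fin k, DifferentiableAt ℂ (fun z : Fin k → ℂ =>
      1 - 1 / ((p : ℕ) : ℂ) ^ (1 + z i + z j)) z := fun i j =>
    (hd _ (by fun_prop)).const_sub 1
  unfold eulerFactor
  fun_prop

lemma eulerA_eq (k : ℕ) (z : Fin k → ℂ) :
    eulerA k z = ∏' p : Nat.Primes, (1 + (eulerFactor k z p - 1)) := by
  simp [eulerA]

/-- The majorant `C p^{-5/4}` gives locally uniform convergence, on the polydisc for continuity and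
on each one-variable slice for holomorphy. -/
lemma sepHolo_eulerA (k : ℕ) : SepHolo (eulerA k) (polydisc k (1 / 12)) where
  cont := by
    obtain ⟨C, hC⟩ := exists_norm_eulerFactor_sub_one_le k
    have h := Summable.hasProdLocallyUniformlyOn_one_add (isOpen_polydisc k (1 / 12))
      (summable_prime_rpow C) (f := fun p z => eulerFactor k z p - 1)
      (Eventually.of_forall fun p z hz => hC z hz p)
      fun p z hz => (((differentiableAt_eulerFactor hz p).continuousAt).sub
        continuousAt_const).continuousWithinAt
    simp only [← eulerA_eq] at h
    rw [hasProdLocallyUniformlyOn_iff_tendstoLocallyUniformlyOn] at h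
    refine h.continuousOn (Frequently.of_forall fun s => ?_)
    refine continuousOn_finsetProd _ fun p _ z hz => ?_
    simp only [add_sub_cancel]
    exact (differentiableAt_eulerFactor hz p).continuousAt.continuousWithinAt
  diff z hz j := by
    obtain ⟨C, hC⟩ := exists_norm_eulerFactor_sub_one_le k
    set V : Set ℂ := (fun w => Function.update z j w) ⁻¹' polydisc k (1 / 12)
    have hV : IsOpen V :=
      (isOpen_polydisc k _).preimage (differentiable_update_apply z j).continuous
    have hd : ∀ p : Nat.Primes, DifferentiableOn ℂ
        (fun w => eulerFactor k (Function.update z j w) p) V := fun p w hw =>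
      ((differentiableAt_eulerFactor hw p).comp w
        (differentiable_update_apply z j w)).differentiableWithinAt
    have h := Summable.hasProdLocallyUniformlyOn_one_add hV
      (summable_prime_rpow C) (f := fun p w => eulerFactor k (Function.update z j w) p - 1)
      (Eventually.of_forall fun p w hw => hC _ hw p) fun p => (hd p).continuousOn.sub continuousOn_const
    simp only [← eulerA_eq] at h
    rw [hasProdLocallyUniformlyOn_iff_tendstoLocallyUniformlyOn] at h
    refine (h.differentiableOn (Eventually.of_forall fun s => ?_) hV).differentiableAt
      (hV.mem_nhds ?_)
    · simp only [add_sub_cancel]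
      exact DifferentiableOn.fun_finsetProd fun p _ => hd p
    · simpa [V] using hz

/-- At the origin the local factor is real and a product of positive terms. -/
lemma eulerFactor_zero_ne_zero (k : ℕ) (p : Nat.Primes) : eulerFactor k (fun _ => 0) p ≠ 0 := by
  have hp : (1 : ℝ) < (p : ℕ) := by exact_mod_cast p.2.one_lt
  set r : ℝ := 1 / ((p : ℕ) : ℝ) ^ (1 / 2 : ℝ) with hr
  have hr0 : 0 < r := by positivity
  have hr1 : r < 1 := by
    rw [hr, div_lt_one (by positivity)]
    exact Real.one_lt_rpow hp (by norm_num)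
  have hinv : 1 / ((p : ℕ) : ℝ) < 1 := by
    rw [div_lt_one (by positivity)]
    exact hp
  have hcast : eulerFactor k (fun _ => 0) p =
      (((∏ i : Fin k, ∏ j ∈ Finset.Ici i, (1 - 1 / ((p : ℕ) : ℝ))) *
        (1 / 2 * ((∏ j : Fin k, (1 - r)⁻¹) + ∏ j : Fin k, (1 + r)⁻¹) + 1 / ((p : ℕ) : ℝ)) *
        (1 + 1 / ((p : ℕ) : ℝ))⁻¹ : ℝ) : ℂ) := by
    have : ((p : ℕ) : ℂ) ^ (1 / 2 : ℂ) = (((p : ℕ) : ℝ) ^ (1 / 2 : ℝ) : ℝ) := by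
      rw [Complex.ofReal_cpow (by positivity)]
      norm_num
    simp only [eulerFactor, add_zero, Complex.cpow_one, this, hr]
    push_cast
    rfl
  rw [hcast, Complex.ofReal_ne_zero]
  have h1 : 0 < 1 - r := by linarith
  have h2 : 0 < 1 - 1 / ((p : ℕ) : ℝ) := by linarith
  positivity

lemma arithConst_ne_zero (k : ℕ) : arithConst k ≠ 0 := by
  rw [arithConst, eulerA_eq]
  refine tprod_one_add_ne_zero_of_summable (fun p => ?_)
    (summable_norm_eulerFactor_sub_one fun j => by norm_num)
  simpa using eulerFactor_zero_ne_zero k p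

/-! ### Regularized zeta and gamma factors -/

/-- The entire function `s ζ(1 + s)`. -/
noncomputable def zetaReg : ℂ → ℂ := Function.update (fun s => s * riemannZeta (1 + s)) 0 1

lemma zetaReg_zero : zetaReg 0 = 1 := by simp [zetaReg]

lemma zetaReg_of_ne {s : ℂ} (hs : s ≠ 0) : zetaReg s = s * riemannZeta (1 + s) := by
  simp [zetaReg, hs]

/-- Removable singularity: the residue of `ζ` at `1` is the value `1` assigned at `0`. -/
lemma differentiable_zetaReg : Differentiable ℂ zetaReg := by
  rw [← differentiableOn_univ,
    ← Complex.differentiableOn_compl_singleton_and_continuousAt_iff (c := 0) univ_mem]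
  constructor
  · intro s hs
    have hs0 : s ≠ 0 := hs.2
    have h1 : DifferentiableAt ℂ riemannZeta (1 + s) := differentiableAt_riemannZeta (by simpa using hs0)
    have h2 : DifferentiableAt ℂ (fun s => s * riemannZeta (1 + s)) s :=
      differentiableAt_id.mul (h1.comp s (by fun_prop))
    refine (h2.congr_of_eventuallyEq ?_).differentiableWithinAt
    filter_upwards [isOpen_ne.mem_nhds hs0] with w hw using zetaReg_of_ne hw
  · rw [zetaReg, continuousAt_update_same]
    have h : Tendsto (fun s : ℂ => 1 + s) (𝓝[≠] 0) (𝓝[≠] 1) := by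
      refine tendsto_nhdsWithin_iff.2 ⟨?_, ?_⟩
      · have : Continuous fun s : ℂ => 1 + s := by fun_prop
        simpa using (this.tendsto 0).mono_left nhdsWithin_le_nhds
      · filter_upwards [self_mem_nhdsWithin] with s hs
        simpa using hs
    simpa [Function.comp_def] using riemannZeta_residue_one.comp h

lemma gammaFactor_half (a : ℕ) : gammaFactor a (1 / 2) = 1 := by
  have h : Complex.Gamma ((1 / 2 + a) / 2) ≠ 0 := Complex.Gamma_ne_zero_of_re_pos (by
    simp; positivity)
  rw [gammaFactor, sub_self, Complex.cpow_zero, one_mul, show (1 : ℂ) - 1 / 2 = 1 / 2 by norm_num,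
    div_self h]

lemma differentiableAt_gammaFactor (a : ℕ) {w : ℂ} (hw : ‖w‖ < 1 / 2) :
    DifferentiableAt ℂ (fun w => gammaFactor a (1 / 2 + w)) w := by
  have hre := abs_lt.1 ((Complex.abs_re_le_norm w).trans_lt hw)
  have hG : ∀ s : ℂ, 0 < s.re → DifferentiableAt ℂ Complex.Gamma s := fun s hs =>
    Complex.differentiableAt_Gamma s fun m h => by
      rw [h] at hs
      simp at hs
      linarith [Nat.cast_nonneg (α := ℝ) m]
  have ha : (0 : ℝ) ≤ a := Nat.cast_nonneg a
  have r1 : 0 < ((1 - (1 / 2 + w) + a) / 2).re := by simp; linarith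
  have r2 : 0 < ((1 / 2 + w + a) / 2).re := by simp; linarith
  unfold gammaFactor
  refine DifferentiableAt.div (DifferentiableAt.mul ?_ ?_) ?_ (Complex.Gamma_ne_zero_of_re_pos r2)
  · exact DifferentiableAt.const_cpow (by fun_prop) (Or.inl (by exact_mod_cast Real.pi_ne_zero))
  · exact (hG _ r1).comp (f := fun w : ℂ => (1 - (1 / 2 + w) + a) / 2) w (by fun_prop)
  · exact (hG _ r2).comp (f := fun w : ℂ => (1 / 2 + w + a) / 2) w (by fun_prop)

/-- By continuity `X(1/2 + w, a)` stays near `X(1/2, a) = 1`, inside the slit plane where the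
principal power is holomorphic. -/
lemma exists_differentiableAt_gammaFactor_cpow (a : ℕ) : ∃ ρ : ℝ, 0 < ρ ∧ ∀ w : ℂ, ‖w‖ < ρ →
    DifferentiableAt ℂ (fun w => gammaFactor a (1 / 2 + w) ^ (-(1 / 2) : ℂ)) w := by
  have h0 : ContinuousAt (fun w => gammaFactor a (1 / 2 + w)) 0 :=
    (differentiableAt_gammaFactor a (by norm_num)).continuousAt
  have h1 : gammaFactor a (1 / 2 + 0) ∈ Complex.slitPlane := by
    rw [add_zero, gammaFactor_half]
    exact Complex.one_mem_slitPlane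
  obtain ⟨ρ, hρ, h⟩ := Metric.eventually_nhds_iff.1
    (h0.eventually (Complex.isOpen_slitPlane.mem_nhds h1))
  refine ⟨min ρ (1 / 2), lt_min hρ (by norm_num), fun w hw => ?_⟩
  exact (differentiableAt_gammaFactor a (hw.trans_le (min_le_right _ _))).cpow_const
    (h (by simpa using hw.trans_le (min_le_left _ _)))

/-- The function `G` with the poles of the zeta factors removed. -/
noncomputable def regularG (a k : ℕ) (z : Fin k → ℂ) : ℂ :=
  eulerA k z * (∏ j : Fin k, gammaFactor a (1 / 2 + z j) ^ (-(1 / 2) : ℂ)) *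
    ∏ i : Fin k, ∏ j ∈ Finset.Ici i, zetaReg (z i + z j)

lemma regularG_zero (a k : ℕ) : regularG a k 0 = arithConst k := by
  simp only [regularG, Pi.zero_apply, add_zero, gammaFactor_half, Complex.one_cpow, zetaReg_zero,
    Finset.prod_const_one, mul_one]
  rfl

lemma exists_sepHolo_regularG (a k : ℕ) : ∃ ρ : ℝ, 0 < ρ ∧ ρ ≤ 1 / 12 ∧
    SepHolo (regularG a k) (polydisc k ρ) := by
  obtain ⟨ρ, hρ, h⟩ := exists_differentiableAt_gammaFactor_cpow a
  refine ⟨min ρ (1 / 12), lt_min hρ (by norm_num), min_le_right _ _, ?_⟩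
  refine (((sepHolo_eulerA k).mono fun z hz j => (hz j).trans_le (min_le_right _ _)).mul
    (sepHolo_of_differentiableAt fun z hz => ?_)).mul (sepHolo_of_differentiableAt fun z _ => ?_)
  · have hj : ∀ j, DifferentiableAt ℂ
        (fun z : Fin k → ℂ => gammaFactor a (1 / 2 + z j) ^ (-(1 / 2) : ℂ)) z := fun j =>
      (h _ ((hz j).trans_le (min_le_left _ _))).comp (f := fun z : Fin k → ℂ => z j) z (by fun_prop)
    fun_prop
  · have := differentiable_zetaReg
    fun_prop

/-! ### Factorization of the integrand -/

lemma vandermondeDet_sq_eq {k : ℕ} (z : Fin k → ℂ) :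
    vandermondeDet (fun j => z j ^ 2) =
      vandermondeDet z * ∏ i, ∏ j ∈ Finset.Ioi i, (z i + z j) := by
  simp only [vandermondeDet, Matrix.det_vandermonde, ← Finset.prod_mul_distrib]
  exact Finset.prod_congr rfl fun i _ => Finset.prod_congr rfl fun j _ => by ring

lemma add_ne_zero_of_vandermondeDet_ne_zero {k : ℕ} {z : Fin k → ℂ} (hz : ∀ j, z j ≠ 0)
    (h : vandermondeDet (fun j => z j ^ 2) ≠ 0) {i j : Fin k} : z i + z j ≠ 0 := by
  intro h0
  have hinj := Matrix.det_vandermonde_ne_zero_iff.1 h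
  have hij : i = j := hinj (show z i ^ 2 = z j ^ 2 by linear_combination (z i - z j) * h0)
  subst hij
  exact hz i (by simpa using h0)

lemma integrand_eq {a k : ℕ} {z : Fin k → ℂ} (hz : ∀ j, z j ≠ 0) (x : ℂ) :
    integrand a k x z =
      1 / 2 ^ k * (regularG a k z * kernel k z * Complex.exp (x / 2 * ∑ j, z j)) := by
  rw [integrand, G, kernel, regularG]
  -- Where `Δ(z²) = 0` both sides vanish, so the value assigned to `ζ` at its pole plays no role;
  -- elsewhere no `z i + z j` is zero.
  by_cases h : vandermondeDet (fun j => z j ^ 2) = 0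
  · simp [h]
  have hreg : ∏ i : Fin k, ∏ j ∈ Finset.Ici i, zetaReg (z i + z j) =
      (2 ^ k * (∏ i, z i) * ∏ i, ∏ j ∈ Finset.Ioi i, (z i + z j)) *
        ∏ i : Fin k, ∏ j ∈ Finset.Ici i, riemannZeta (1 + z i + z j) := by
    have h2 : (2 : ℂ) ^ k * ∏ i, z i = ∏ i, (z i + z i) := by
      simp only [← two_mul, Finset.prod_mul_distrib, Finset.prod_const, Finset.card_univ,
        Fintype.card_fin]
    rw [h2, ← Finset.prod_mul_distrib, ← Finset.prod_mul_distrib]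
    refine Finset.prod_congr rfl fun i _ => ?_
    rw [Finset.mul_prod_Ioi_eq_prod_Ici (f := fun j => z i + z j) i, ← Finset.prod_mul_distrib]
    refine Finset.prod_congr rfl fun j _ => ?_
    rw [zetaReg_of_ne (add_ne_zero_of_vandermondeDet_ne_zero hz h), add_assoc]
  have hpow : ∏ j, z j ^ (2 * k) = (∏ j, z j ^ (2 * k - 1)) * ∏ j, z j := by
    rw [← Finset.prod_mul_distrib]
    refine Finset.prod_congr rfl fun j _ => ?_
    rw [← pow_succ]
    -- An index `j` forces `k > 0`, so the natural subtraction `2k - 1` is not truncated.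
    have := j.pos
    congr 1
    omega
  have hz1 : ∏ j, z j ≠ 0 := Finset.prod_ne_zero_iff.2 fun j _ => hz j
  have hz2 : ∏ j, z j ^ (2 * k - 1) ≠ 0 := Finset.prod_ne_zero_iff.2 fun j _ => pow_ne_zero _ (hz j)
  rw [hreg, hpow, vandermondeDet_sq_eq]
  field_simp

end QuadMoment

/-! ### The polynomial and its leading coefficient -/

open QuadMoment in
theorem mainTheorem5 (k a : ℕ) (ha : a = 0 ∨ a = 1) :
    ∃ P : Polynomial ℂ,
      (∃ ρ : ℝ, 0 < ρ ∧
        (∀ z : Fin k → ℂ, (∀ j, ‖z j‖ < ρ) →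
          Summable fun p : Nat.Primes => ‖QuadMoment.eulerFactor k z p - 1‖) ∧
        ∀ R : Fin k → ℝ, (∀ j, 0 < R j ∧ R j < ρ) → ∀ x : ℂ,
          TorusIntegrable (QuadMoment.integrand a k x) 0 R ∧
            QuadMoment.Q a k R x = P.eval x) ∧
      P.natDegree = k * (k + 1) / 2 ∧
      P.leadingCoeff = QuadMoment.arithConst k / 2 ^ k *
        ∏ j ∈ Finset.range k, (((2 * j)! : ℕ) : ℂ) / (((k + j)! : ℕ) : ℂ) := by
  obtain ⟨ρ, hρ, hρ', hG⟩ := exists_sepHolo_regularG a k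
  have hL := sepHolo_kernel k ρ
  have hom := kernel_homogeneous k
  set N := k * (k + 1) / 2 with hN
  set R₀ : Fin k → ℝ := fun _ => ρ / 2
  have hR₀ : ∀ j, 0 < R₀ j ∧ R₀ j < ρ := fun j => ⟨half_pos hρ, half_lt_self hρ⟩
  set c : ℂ := (-1) ^ (k * (k - 1) / 2) * 2 ^ k / (k ! : ℂ) *
    (1 / (2 * Real.pi * Complex.I) ^ k) with hc
  -- The factor `2^k` comes from `integrand_eq`, and `2^m` from the exponent `x/2`.
  set b : ℕ → ℂ := fun m => c / 2 ^ k * (moment (regularG a k) (kernel k) R₀ m / (m ! : ℂ) / 2 ^ m)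
    with hb
  have hbN : b N = arithConst k / 2 ^ k *
      ∏ j ∈ Finset.range k, (((2 * j)! : ℕ) : ℂ) / (((k + j)! : ℕ) : ℂ) := by
    have h1 := moment_add hρ hG hL hom hR₀ 0
    have h2 := torusIntegral_kernel_mul_exp hL hom hR₀
    rw [torusIntegral_kernel_exp_eq_det k hR₀, det_invFactorial] at h2
    rw [pow_zero, one_mul, add_zero, regularG_zero] at h1
    -- Splits `2^N`: one part cancels the power of `2` in `(-2)^{k(k-1)/2}`, and the other is the
    -- `2^k` of the final formula.
    have hNd : N = k * (k - 1) / 2 + k := by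
      rw [hN, ← Nat.triangle_succ]
      simp [mul_comm]
    have hpi : (2 * Real.pi * Complex.I : ℂ) ^ k ≠ 0 := pow_ne_zero _ Complex.two_pi_I_ne_zero
    have hk : (k ! : ℂ) ≠ 0 := by exact_mod_cast Nat.factorial_ne_zero k
    have hsq : ((-1 : ℂ) ^ (k * (k - 1) / 2)) * (-1) ^ (k * (k - 1) / 2) = 1 := by
      rw [← mul_pow]
      simp
    rw [hb]
    simp only
    rw [h1, mul_div_assoc (arithConst k), ← h2, hc, hNd, pow_add (2 : ℂ), neg_pow (2 : ℂ)]
    field_simp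
    linear_combination (arithConst k *
      ∏ j ∈ Finset.range k, (((2 * j)! : ℕ) : ℂ) / (((k + j)! : ℕ) : ℂ)) * hsq
  have hbN0 : b N ≠ 0 := by
    rw [hbN]
    refine mul_ne_zero (div_ne_zero (arithConst_ne_zero k) (by simp))
      (Finset.prod_ne_zero_iff.2 fun j _ => ?_)
    exact div_ne_zero (by exact_mod_cast Nat.factorial_ne_zero _)
      (by exact_mod_cast Nat.factorial_ne_zero _)
  set P : Polynomial ℂ := ∑ m ∈ Finset.range (N + 1), Polynomial.monomial m (b m) with hP
  have hcoeff : P.coeff N = b N := by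
    simp [hP, Polynomial.coeff_monomial]
  have hdeg : P.natDegree = N := by
    refine Polynomial.natDegree_eq_of_le_of_coeff_ne_zero
      (Polynomial.natDegree_sum_le_of_forall_le _ _ fun m hm => ?_) (hcoeff ▸ hbN0)
    exact (Polynomial.natDegree_monomial_le _).trans (Finset.mem_range_succ_iff.1 hm)
  refine ⟨P, ⟨ρ, hρ, fun z hz => ?_, fun R hR x => ?_⟩, hdeg, ?_⟩
  · exact summable_norm_eulerFactor_sub_one fun j => (hz j).trans_le hρ'
  · have hs : SepHolo (fun z => regularG a k z * kernel k z * Complex.exp (x / 2 * ∑ j, z j))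
        (punctPolydisc k ρ) := ((hG.mono (punctPolydisc_subset k ρ)).mul hL).mul
      (sepHolo_of_differentiableAt fun z _ => by fun_prop)
    refine ⟨ContinuousOn.torusIntegrable (ρ := ρ) ?_ hR, ?_⟩
    · exact (continuousOn_const.mul hs.cont).congr fun z hz => integrand_eq (fun j => (hz j).1) x
    · rw [Q, torusIntegral_congr hR fun z hz => integrand_eq (fun j => (hz j).1) x,
        torusIntegral_const_mul, hs.torusIntegral_eq hR hR₀,
        torusIntegral_exp_eq_sum hρ hG hL hom hR₀, hP, Polynomial.eval_finsetSum, ← hc,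
        ← mul_assoc, Finset.mul_sum]
      refine Finset.sum_congr rfl fun m _ => ?_
      rw [Polynomial.eval_monomial, hb, div_pow]
      ring
  · rw [Polynomial.leadingCoeff, hdeg, hcoeff, hbN]
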